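/- Work in the deterministic, synchronous $\mathsf{CONGEST}$ model: in each round every vertex of an $n$-vertex graph sends a message of $O(\log n)$ bits through each of its incident edges (ports), local computation is free, initially a vertex knows only its degree and its local input, and the algorithm may depend on the global parameters $n,\varphi,L$. The graphs are $\varphi$-expanders ($\varphi>0$, every cut $\emptyset\ne S\subsetneq V$ has conductance $|\delta(S)|/\min(\mathrm{vol}(S),\mathrm{vol}(V\setminus S))\ge\varphi$) with maximum degree at most a constant $\Delta$. All identifiers, keys, destinations and further token contents are taken from a range of size $\mathrm{poly}(n)$, and the load satisfies $1\le L\le \mathrm{poly}(n)$. - $\mathrm{ExpanderSorting}$ with load $L$: every vertex $v$ has a unique identifier $\mathit{ID}(v)$ and holds at most $L$ tokens; each token $z$ has a key $k_z$ (and carries a further content). Redistribute the tokens so that every vertex holds at most $L$ tokens and, for all tokens $z,z'$ located at $v,v'$ with $\mathit{ID}(v)<\mathit{ID}(v')$, $k_z\le k_{z'}$. - $\mathrm{ExpanderRouting}$ with load $L$: every vertex $v$ has a unique identifier $\mathit{ID}(v)$ and holds at most $L$ tokens; each token $z$ has a destination identifier $\mathit{dst}_z$ (and carries a further content), and at most $L$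 tokens have the same destination identifier. Redistribute the tokens so that, for every vertex $v$, all tokens with $\mathit{dst}_z=\mathit{ID}(v)$ are located at $v$. **Lemma.** Let $T_{\mathrm{sort}}(n,\varphi,L)\in\mathbb N$ be a function such that, for all $n\ge1$, $\varphi>0$ and $1\le L\le\mathrm{poly}(n)$, $\mathrm{ExpanderSorting}$ with load $L$ is solved on all these $n$-vertex $\varphi$-expanders by some (not necessarily comparison-based) $\mathsf{CONGEST}$ algorithm in $T_{\mathrm{sort}}(n,\varphi,L)$ rounds; precisely, for every exponent $c$ there is a constant $b$ such that messages of $b\log_2 n$ bits suffice when all ranges have size $n^c$ and $L\le n^c$. Then $\mathrm{ExpanderRouting}$ with load $L$ is solved on these graphs by a $\mathsf{CONGEST}$ algorithm in $O(\log_{L+1}n)\cdot T_{\mathrm{sort}}(n,\varphi,2L)$ rounds; precisely, for every exponent $c$ there are a constant $C>0$ depending only on $c$ and $\Delta$, and a constant $b$, such that for all $n\ge1$, $\varphi>0$ and $1\le L\le n^c$ the number of rounds is at most $C\cdot\log_{L+1}(n)\cdot T_{\mathrm{sort}}(n,\varphi,2L)$ with messages of $b\log_2 n$ bits, when all ranges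 have size $n^c$. -/

import Mathlib

namespace Congest

/-! ### Conductance -/

open scoped Classical in
/-- `vol S`: the sum of the degrees of the vertices of `S`. -/
noncomputable def vol {n : ℕ} (G : SimpleGraph (Fin n)) (S : Finset (Fin n)) : ℕ :=
  ∑ v ∈ S, G.degree v

open scoped Classical in
/-- The conductance `|δ(S)| / min (vol S, vol (V \ S))` of a cut `S`.  (If the denominator is
zero there are no crossing edges, and the value is `0`.) -/
noncomputable def cutConductance {n : ℕ} (G : SimpleGraph (Fin n)) (S : Finset (Fin n)) : ℝ :=
  ((G.interedges S Sᶜ).card : ℝ) / (min (vol G S) (vol G Sᶜ) : ℕ)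

/-- `G` is a `φ`-expander: every cut `S` with `∅ ≠ S ≠ V` has conductance at least `φ`. -/
def IsExpander {n : ℕ} (G : SimpleGraph (Fin n)) (φ : ℝ) : Prop :=
  ∀ S : Finset (Fin n), S.Nonempty → S ≠ Finset.univ → φ ≤ cutConductance G S

/-! ### The CONGEST model -/

open scoped Classical in
/-- A communication network on `n` vertices: a simple graph in which every vertex numbers its
incident edges by ports `0, …, deg v - 1` in an arbitrary way; `nbr v i` is the neighbor of `v`
behind port `i`.  The names of the vertices (elements of `Fin n`) are not visible to algorithms. -/
structure Network (n : ℕ) where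
  graph : SimpleGraph (Fin n)
  nbr : (v : Fin n) → Fin (graph.degree v) ≃ graph.neighborSet v

/-- A deterministic node program for `n`-vertex networks in which a message is an element of
`Fin (n ^ b)`, that is, a string of `b * log₂ n = O(log n)` bits.  Every vertex runs the same
program. Initially a vertex knows its degree and its local input (and the program itself may depend
on all global parameters).  Local computation is free. -/
structure NodeProgram (n b : ℕ) (In Out : Type) where
  /-- local states -/
  State : Type
  /-- the initial state, from the degree and the local input -/
  init : ℕ → In → State
  /-- the message sent through a given port in the current round -/
  send : State → ℕ → Fin (n ^ b)
  /-- the new state, from the old one and the messages received through the ports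
  (`none` at numbers that are not ports of the vertex) -/
  receive : State → (ℕ → Option (Fin (n ^ b))) → State
  /-- the local output -/
  output : State → Out

namespace NodeProgram

variable {n b : ℕ} {In Out : Type}

open scoped Classical in
/-- The messages that reach vertex `v` in one round if the vertices are in the states `s`. -/
noncomputable def inbox (A : NodeProgram n b In Out) (N : Network n) (s : Fin n → A.State)
    (v : Fin n) (i : ℕ) : Option (Fin (n ^ b)) :=
  if h : i < N.graph.degree v then
    let w := N.nbr v ⟨i, h⟩
    some (A.send (s w) ((N.nbr w).symm ⟨v, w.2.symm⟩))
  else none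

/-- One synchronous round. -/
noncomputable def round (A : NodeProgram n b In Out) (N : Network n) (s : Fin n → A.State) :
    Fin n → A.State :=
  fun v => A.receive (s v) (A.inbox N s v)

open scoped Classical in
/-- The states before the first round. -/
noncomputable def start (A : NodeProgram n b In Out) (N : Network n) (x : Fin n → In) :
    Fin n → A.State :=
  fun v => A.init (N.graph.degree v) (x v)

/-- The local outputs after `t` rounds on network `N` with local inputs `x`. -/
noncomputable def run (A : NodeProgram n b In Out) (N : Network n) (x : Fin n → In) (t : ℕ) :
    Fin n → Out :=
  fun v => A.output (((A.round N)^[t] (A.start N x)) v)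

end NodeProgram

/-! ### Expander sorting and expander routing

Identifiers, keys, destinations and the further contents of tokens come from the polynomial range
`Fin (n ^ c)`. -/

/-- A token: a `label` (its key, when sorting; its destination identifier, when routing) and a
further content `msg` that the token carries along. -/
@[ext] structure Token (n c : ℕ) where
  label : Fin (n ^ c)
  msg : Fin (n ^ c)

/-- The local input of a vertex: its identifier and the tokens that it holds. -/
structure NodeInput (n c : ℕ) where
  id : Fin (n ^ c)
  tokens : Multiset (Token n c)

/-- The inputs of expander sorting with load `L`: unique identifiers and at most `L` tokens on each
vertex. -/
def IsSortingInput {n c : ℕ} (L : ℕ) (x : Fin n → NodeInput n c) : Prop :=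
  Function.Injective (fun v => (x v).id) ∧ ∀ v, (x v).tokens.card ≤ L

/-- The goal of expander sorting: the tokens have been redistributed (none is lost, created or
altered), there are at most `L` of them on each vertex, and the keys are sorted along the
identifiers of the vertices. -/
def IsSorted {n c : ℕ} (L : ℕ) (x : Fin n → NodeInput n c)
    (y : Fin n → Multiset (Token n c)) : Prop :=
  ∑ v, y v = ∑ v, (x v).tokens ∧
  (∀ v, (y v).card ≤ L) ∧
  ∀ v v', (x v).id < (x v').id → ∀ z ∈ y v, ∀ z' ∈ y v', z.label ≤ z'.label

/-- The inputs of expander routing with load `L`: unique identifiers, at most `L` tokens on each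
vertex, and at most `L` tokens with any given destination identifier. -/
def IsRoutingInput {n c : ℕ} (L : ℕ) (x : Fin n → NodeInput n c) : Prop :=
  Function.Injective (fun v => (x v).id) ∧ (∀ v, (x v).tokens.card ≤ L) ∧
  ∀ d : Fin (n ^ c), (∑ v, (x v).tokens).countP (fun z => z.label = d) ≤ L

/-- The goal of expander routing: the tokens have been redistributed (none is lost, created or
altered), and every token whose destination is the identifier of `v` is located at `v`. -/
def IsRouted {n c : ℕ} (x : Fin n → NodeInput n c) (y : Fin n → Multiset (Token n c)) : Prop :=
  ∑ v, y v = ∑ v, (x v).tokens ∧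
  ∀ u v, ∀ z ∈ y u, z.label = (x v).id → u = v

open scoped Classical in
/-- The networks under consideration: `φ`-expanders of maximum degree at most `Δ`. -/
def Network.Admissible {n : ℕ} (N : Network n) (Δ : ℕ) (φ : ℝ) : Prop :=
  IsExpander N.graph φ ∧ ∀ v, N.graph.degree v ≤ Δ

/-- Some CONGEST algorithm with messages of `b * log₂ n` bits solves expander sorting with load `L`
in `t` rounds on all `φ`-expanders with `n` vertices and maximum degree at most `Δ`. -/
def SortingSolvable (Δ c b n : ℕ) (φ : ℝ) (L t : ℕ) : Prop :=
  ∃ A : NodeProgram n b (NodeInput n c) (Multiset (Token n c)),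
    ∀ N : Network n, N.Admissible Δ φ →
      ∀ x : Fin n → NodeInput n c, IsSortingInput L x → IsSorted L x (A.run N x t)

/-- Some CONGEST algorithm with messages of `b * log₂ n` bits solves expander routing with load `L`
in `t` rounds on all `φ`-expanders with `n` vertices and maximum degree at most `Δ`. -/
def RoutingSolvable (Δ c b n : ℕ) (φ : ℝ) (L t : ℕ) : Prop :=
  ∃ A : NodeProgram n b (NodeInput n c) (Multiset (Token n c)),
    ∀ N : Network n, N.Admissible Δ φ →
      ∀ x : Fin n → NodeInput n c, IsRoutingInput L x → IsRouted x (A.run N x t)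

end Congest

namespace Congest

/-! ### Composition of node programs -/

/-! Six sorts with load `2 * L` suffice. Every vertex creates exactly `2 * L` items: its at most `L`
tokens are the payloads of items with index below `L`, and the items with index at least `L` are
empty slots. Since the total number of items equals the total capacity, a redistribution with load
`2 * L` fills every vertex exactly. Hence, after sorting by an injective key, the item of rank `r`
sits at the vertex whose identifier has rank `r / (2 * L)` (`rank_location`).

A vertex sees only its own block of `2 * L` consecutive items. To compare nearby items across block
boundaries, the vertex of smallest identifier, which recognizes itself after one preliminary sort
(`config_setFlag`), sends its `L` smallest items to the end of the order. A second sort then shows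
all later blocks shifted by `L`. Two items whose ranks differ by at most `L` meet in at least one of
the two sorts (`Config.twoWindows`).

This is used twice. Sorting by destination, each token learns its position `p` among the at most `L`
tokens with the same destination `d` (`Config.positions`). Then the token is matched with slot `L +
p` of vertex `d`, in an order in which the two are neighbors, and both exchange their homes
(`Config.matching`). The exchange is an involution of the items, so every vertex is the home of
exactly `2 * L` items, and a last sort by home delivers all of them (`Config.sort_home`). The count
is 1 + 2 + 2 + 1 = 6.

The logarithmic factor is needed only as an upper bound: for `n ≥ 2` and `L ≤ n ^ c` it is at least
`1 / (c + 1)`, and for `n = 1`, where it vanishes, no communication is required. -/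

/-- Some program with messages from `Fin (n ^ b)` produces, in `t` rounds on every admissible
network, local outputs that are related by `R` to the local inputs. -/
def Computes (Δ b n : ℕ) (φ : ℝ) {In Out : Type} (t : ℕ)
    (R : (Fin n → In) → (Fin n → Out) → Prop) : Prop :=
  ∃ A : NodeProgram n b In Out, ∀ N : Network n, N.Admissible Δ φ → ∀ x, R x (A.run N x t)

namespace NodeProgram

variable {n b : ℕ} {In Mid Out : Type}

/-- The state in which `A` still has to run for `k` rounds before `B` takes over. -/
def enter (A : NodeProgram n b In Mid) (B : NodeProgram n b Mid Out) (k d : ℕ) (s : A.State) :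
    (ℕ × ℕ × A.State) ⊕ B.State :=
  if k = 0 then Sum.inr (B.init d (A.output s)) else Sum.inl (k, d, s)

/-- Run `A` for `t` rounds and then `B` on the outputs of `A`. -/
def seq (A : NodeProgram n b In Mid) (t : ℕ) (B : NodeProgram n b Mid Out) :
    NodeProgram n b In Out where
  State := (ℕ × ℕ × A.State) ⊕ B.State
  init d x := enter A B t d (A.init d x)
  send s i := s.elim (fun q => A.send q.2.2 i) (fun q => B.send q i)
  receive s m :=
    s.elim (fun q => enter A B (q.1 - 1) q.2.1 (A.receive q.2.2 m)) (fun q => Sum.inr (B.receive q m))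
  output s := s.elim (fun q => B.output (B.init q.2.1 (A.output q.2.2))) B.output

/-- A simulation principle: `g k` embeds the simulated states together with a countdown `k`, and one
step of `F` performs one step of `G` while consuming one tick. -/
theorem iterate_apply_family {S T : Type*} {F : S → S} {G : T → T} {g : ℕ → T → S}
    (h : ∀ k s, F (g (k + 1) s) = g k (G s)) (k : ℕ) (s : T) : F^[k] (g k s) = g 0 (G^[k] s) := by
  induction k generalizing s with
  | zero => rfl
  | succ k ih => rw [Function.iterate_succ_apply, h, ih, Function.iterate_succ_apply]

-- `enter` switches to `B` as soon as the countdown is zero, so the handover costs no extra round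
-- and round numbers simply add up.
open scoped Classical in
theorem seq_iterate_enter (A : NodeProgram n b In Mid) (t : ℕ) (B : NodeProgram n b Mid Out)
    (N : Network n) (k : ℕ) (s : Fin n → A.State) :
    ((A.seq t B).round N)^[k] (fun v => enter A B k (N.graph.degree v) (s v)) =
      fun v => enter A B 0 (N.graph.degree v) ((A.round N)^[k] s v) := by
  refine iterate_apply_family (F := (A.seq t B).round N) (G := A.round N)
    (g := fun k s v => enter A B k (N.graph.degree v) (s v)) (fun k s => ?_) k s
  funext v
  simp only [round, seq, enter, Nat.add_eq_zero_iff, one_ne_zero, and_false, if_false, Sum.elim_inl,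
    Nat.add_sub_cancel]
  rfl

theorem seq_iterate_inr (A : NodeProgram n b In Mid) (t : ℕ) (B : NodeProgram n b Mid Out)
    (N : Network n) (k : ℕ) (s : Fin n → B.State) :
    ((A.seq t B).round N)^[k] (fun v => (Sum.inr (s v) : (ℕ × ℕ × A.State) ⊕ B.State)) =
      fun v => (Sum.inr ((B.round N)^[k] s v) : (ℕ × ℕ × A.State) ⊕ B.State) :=
  iterate_apply_family (F := (A.seq t B).round N) (G := B.round N)
    (g := fun _ s v => (Sum.inr (s v) : (ℕ × ℕ × A.State) ⊕ B.State)) (fun _ _ => rfl) k s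

theorem seq_run (A : NodeProgram n b In Mid) (B : NodeProgram n b Mid Out)
    (N : Network n) (x : Fin n → In) (t t' : ℕ) :
    (A.seq t B).run N x (t' + t) = B.run N (A.run N x t) t' := by
  funext v
  have h : ((A.seq t B).round N)^[t] ((A.seq t B).start N x) =
      fun v => (Sum.inr (B.start N (A.run N x t) v) : (ℕ × ℕ × A.State) ⊕ B.State) :=
    seq_iterate_enter A t B N t (A.start N x)
  simp only [run, Function.iterate_add_apply]
  rw [h, seq_iterate_inr]
  rfl

variable {M M' : Type}

/-- Run `A` on an input computed from a local memory, and combine memory and output. -/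
def withMemory (A : NodeProgram n b In Out) (pre : M → In) (post : M → Out → M') :
    NodeProgram n b M M' where
  State := M × A.State
  init d m := (m, A.init d (pre m))
  send s i := A.send s.2 i
  receive s m := (s.1, A.receive s.2 m)
  output s := post s.1 (A.output s.2)

theorem withMemory_iterate (A : NodeProgram n b In Out) (pre : M → In) (post : M → Out → M')
    (N : Network n) (m : Fin n → M) (t : ℕ) (s : Fin n → A.State) :
    ((A.withMemory pre post).round N)^[t] (fun v => ((m v, s v) : M × A.State)) =
      fun v => ((m v, (A.round N)^[t] s v) : M × A.State) :=
  iterate_apply_family (F := (A.withMemory pre post).round N) (G := A.round N)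
    (g := fun _ s v => ((m v, s v) : M × A.State)) (fun _ _ => rfl) t s

theorem withMemory_run (A : NodeProgram n b In Out) (pre : M → In) (post : M → Out → M')
    (N : Network n) (m : Fin n → M) (t : ℕ) :
    (A.withMemory pre post).run N m t = fun v => post (m v) (A.run N (fun v => pre (m v)) t v) := by
  have h : ((A.withMemory pre post).round N)^[t] ((A.withMemory pre post).start N m) = _ :=
    withMemory_iterate A pre post N m t (A.start N fun v => pre (m v))
  funext v
  simp only [run]
  rw [h]
  rfl

end NodeProgram

namespace Computes

variable {Δ b n : ℕ} {φ : ℝ} {In Mid Out M M' : Type} {t t' : ℕ}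

theorem comp {R : (Fin n → In) → (Fin n → Mid) → Prop} {R' : (Fin n → Mid) → (Fin n → Out) → Prop}
    (h : Computes Δ b n φ t R) (h' : Computes Δ b n φ t' R') :
    Computes Δ b n φ (t' + t) (fun x z => ∃ y, R x y ∧ R' y z) := by
  obtain ⟨A, hA⟩ := h
  obtain ⟨B, hB⟩ := h'
  refine ⟨A.seq t B, fun N hN x => ⟨_, hA N hN x, ?_⟩⟩
  rw [NodeProgram.seq_run]
  exact hB N hN _

theorem withMemory {R : (Fin n → In) → (Fin n → Out) → Prop} (h : Computes Δ b n φ t R)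
    (pre : M → In) (post : M → Out → M') :
    Computes Δ b n φ t (fun (m : Fin n → M) (m' : Fin n → M') =>
      ∃ y, R (fun v => pre (m v)) y ∧ m' = fun v => post (m v) (y v)) := by
  obtain ⟨A, hA⟩ := h
  refine ⟨A.withMemory pre post, fun N hN m => ⟨_, hA N hN _, ?_⟩⟩
  rw [NodeProgram.withMemory_run]

theorem mono {R R' : (Fin n → In) → (Fin n → Out) → Prop} (h : Computes Δ b n φ t R)
    (hR : ∀ x y, R x y → R' x y) : Computes Δ b n φ t R' := by
  obtain ⟨A, hA⟩ := h
  exact ⟨A, fun N hN x => hR _ _ (hA N hN x)⟩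

end Computes

/-! ### Ranks -/

section Rank

variable {ι K : Type*} [Fintype ι] [LinearOrder K]

/-- The number of indices with a smaller key. -/
def rank (key : ι → K) (i : ι) : ℕ :=
  (Finset.univ.filter fun j => key j < key i).card

theorem rank_lt_rank (key : ι → K) {i j : ι} : rank key i < rank key j ↔ key i < key j := by
  constructor
  · intro h
    by_contra hij
    rw [not_lt] at hij
    refine absurd h (not_lt.2 (Finset.card_le_card fun x hx => ?_))
    simp only [Finset.mem_filter, Finset.mem_univ, true_and] at hx ⊢
    exact hx.trans_le hij
  · intro h
    refine Finset.card_lt_card ⟨fun x hx => ?_, fun hs => ?_⟩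
    · simp only [Finset.mem_filter, Finset.mem_univ, true_and] at hx ⊢
      exact hx.trans h
    · have := hs (Finset.mem_filter.2 ⟨Finset.mem_univ i, h⟩)
      simp at this

theorem rank_injective {key : ι → K} (hk : Function.Injective key) :
    Function.Injective (rank key) := by
  intro i j hij
  apply hk
  rcases lt_trichotomy (key i) (key j) with h | h | h
  · exact absurd hij ((rank_lt_rank key).2 h).ne
  · exact h
  · exact absurd hij ((rank_lt_rank key).2 h).ne'

theorem rank_lt_card (key : ι → K) (i : ι) : rank key i < Fintype.card ι := by
  refine Finset.card_lt_card ⟨Finset.filter_subset _ _, fun h => ?_⟩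
  have := h (Finset.mem_univ i)
  simp at this

theorem image_rank [DecidableEq ι] {key : ι → K} (hk : Function.Injective key) :
    Finset.univ.image (rank key) = Finset.range (Fintype.card ι) := by
  refine Finset.eq_of_subset_of_card_le (fun m hm => ?_) ?_
  · obtain ⟨i, -, rfl⟩ := Finset.mem_image.1 hm
    exact Finset.mem_range.2 (rank_lt_card key i)
  · rw [Finset.card_image_of_injective _ (rank_injective hk), Finset.card_range, Finset.card_univ]

theorem card_filter_rank_lt {key : ι → K} (hk : Function.Injective key) {m : ℕ}
    (hm : m ≤ Fintype.card ι) : (Finset.univ.filter fun i => rank key i < m).card = m := by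
  classical
  rw [← Finset.card_image_of_injective _ (rank_injective hk)]
  have : (Finset.univ.filter fun i => rank key i < m).image (rank key) = Finset.range m := by
    ext k
    simp only [Finset.mem_image, Finset.mem_filter, Finset.mem_univ, true_and, Finset.mem_range]
    constructor
    · rintro ⟨i, hi, rfl⟩
      exact hi
    · intro hkm
      have : k ∈ Finset.univ.image (rank key) := by
        rw [image_rank hk]
        exact Finset.mem_range.2 (hkm.trans_le hm)
      obtain ⟨i, -, rfl⟩ := Finset.mem_image.1 this
      exact ⟨i, hkm, rfl⟩
  rw [this, Finset.card_range]

/-- If the first `m` indices are moved to the end, then the rank of the others drops by `m`. -/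
theorem rank_toLex_of_le {key : ι → K} (hk : Function.Injective key) {m : ℕ} (dem : ι → Bool)
    (hdem : ∀ i, dem i = true ↔ rank key i < m) {i : ι} (hi : m ≤ rank key i) :
    rank (fun j => toLex (dem j, key j)) i = rank key i - m := by
  classical
  have hi' : dem i = false := by
    rw [Bool.eq_false_iff, Ne, hdem]
    omega
  have h1 : (Finset.univ.filter fun j => toLex (dem j, key j) < toLex (dem i, key i)) =
      (Finset.univ.filter fun j => key j < key i) \ (Finset.univ.filter fun j => rank key j < m) := by
    ext j
    have := hdem j
    have hlt := rank_lt_rank key (i := j) (j := i)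
    simp only [Finset.mem_filter, Finset.mem_univ, true_and, Finset.mem_sdiff, Prod.Lex.toLex_lt_toLex,
      hi']
    cases hj : dem j
    · simp [hj] at this ⊢
      grind
    · have htf : ¬ (true < false) := by decide
      simp [hj] at this ⊢
      grind
  have h2 : (Finset.univ.filter fun j => rank key j < m) ⊆ Finset.univ.filter fun j => key j < key i := by
    intro j hj
    simp only [Finset.mem_filter, Finset.mem_univ, true_and] at hj ⊢
    exact (rank_lt_rank key).1 (hj.trans_le hi)
  rw [rank, h1, Finset.card_sdiff_of_subset h2,
    card_filter_rank_lt hk (hi.trans (rank_lt_card key i).le)]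
  rfl

end Rank

/-! ### Redistributions of full load -/

section Locations

variable {n : ℕ} {ι K I α : Type*} [Fintype ι] [LinearOrder K] [LinearOrder I]

/-- Injectivity of `f` makes the total multiset duplicate-free, so each item lies at one vertex only
and a redistribution becomes a function on indices. -/
theorem exists_location {f : ι → α} (hf : Function.Injective f) (Y : Fin n → Multiset α)
    (hY : ∑ v, Y v = Finset.univ.val.map f) :
    ∃ loc : ι → Fin n, ∀ v, Y v = (Finset.univ.filter fun i => loc i = v).val.map f := by
  classical
  have hnd : (∑ v, Y v).Nodup := by
    rw [hY]
    exact Finset.univ.nodup.map hf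
  have hle : ∀ v, Y v ≤ ∑ v, Y v := fun v =>
    Finset.single_le_sum (f := Y) (fun _ _ => Multiset.zero_le _) (Finset.mem_univ v)
  have hex : ∀ i, ∃ v, f i ∈ Y v := fun i => by
    have : f i ∈ ∑ v, Y v := by
      rw [hY]
      exact Multiset.mem_map_of_mem f (Finset.mem_univ_val i)
    simpa [Multiset.mem_sum] using this
  choose loc hloc using hex
  have huniq : ∀ i v, f i ∈ Y v → loc i = v := by
    intro i v hv
    -- Two different vertices holding `f i` would give it multiplicity at least two in the total.
    by_contra hne
    have h1 : (∑ u ∈ {loc i, v}, Y u) ≤ ∑ u, Y u :=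
      Finset.sum_le_sum_of_subset (Finset.subset_univ _)
    rw [Finset.sum_pair hne] at h1
    exact Multiset.disjoint_left.1 (Multiset.nodup_add.1 (Multiset.nodup_of_le h1 hnd)).2.2
      (hloc i) hv
  refine ⟨loc, fun v => (Multiset.Nodup.ext (Multiset.nodup_of_le (hle v) hnd)
    ((Finset.nodup _).map hf)).2 fun z => ?_⟩
  simp only [Multiset.mem_map, Finset.mem_val, Finset.mem_filter, Finset.mem_univ, true_and]
  constructor
  · intro hz
    have : z ∈ Finset.univ.val.map f := hY ▸ Multiset.mem_of_le (hle v) hz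
    obtain ⟨i, -, rfl⟩ := Multiset.mem_map.1 this
    exact ⟨i, huniq i v hz, rfl⟩
  · rintro ⟨i, rfl, rfl⟩
    exact hloc i

theorem card_filter_location {W : ℕ} (hcard : Fintype.card ι = n * W) (loc : ι → Fin n)
    (hW : ∀ v, (Finset.univ.filter fun i => loc i = v).card ≤ W) (v : Fin n) :
    (Finset.univ.filter fun i => loc i = v).card = W := by
  have h := Finset.card_eq_sum_card_fiberwise (s := (Finset.univ : Finset ι))
    (t := (Finset.univ : Finset (Fin n))) (f := loc) (fun _ _ => Finset.mem_univ _)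
  rw [Finset.card_univ, hcard] at h
  have h2 : ∑ v : Fin n, (Finset.univ.filter fun i => loc i = v).card = ∑ _v : Fin n, W := by
    rw [← h]
    simp
  exact (Finset.sum_eq_sum_iff_of_le fun v _ => hW v).1 h2 v (Finset.mem_univ v)

theorem card_filter_lt_location {W : ℕ} (loc : ι → Fin n) (id : Fin n → I)
    (hW : ∀ v, (Finset.univ.filter fun i => loc i = v).card = W) (v : Fin n) :
    (Finset.univ.filter fun i => id (loc i) < id v).card = W * rank id v := by
  classical
  rw [Finset.card_eq_sum_card_fiberwise (f := loc)
    (t := Finset.univ.filter fun u => id u < id v)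
    (fun i hi => by simpa using hi)]
  rw [Finset.sum_congr rfl (g := fun _ => W)]
  · simp [rank, mul_comm]
  · intro u hu
    rw [← hW u, Finset.filter_filter]
    congr 1
    ext i
    simp only [Finset.mem_filter, Finset.mem_univ, true_and] at hu ⊢
    constructor
    · exact fun h => h.2
    · rintro rfl
      exact ⟨hu, rfl⟩

/-- The predecessors of `i` are all items at vertices of smaller identifier, `W` at each, and fewer
than `W` items at its own vertex. This is division with remainder by `W`. -/
theorem rank_location {W : ℕ} (loc : ι → Fin n) (id : Fin n → I) (hid : Function.Injective id)
    (hW : ∀ v, (Finset.univ.filter fun i => loc i = v).card = W)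
    {key : ι → K} (hk : Function.Injective key)
    (hs : ∀ i j, id (loc i) < id (loc j) → key i ≤ key j) (i : ι) :
    rank id (loc i) = rank key i / W := by
  classical
  set B := Finset.univ.filter fun j => loc j = loc i ∧ key j < key i
  have hB : B.card < W := by
    rw [← hW (loc i)]
    refine Finset.card_lt_card ⟨fun j hj => ?_, fun h => ?_⟩
    · simp only [B, Finset.mem_filter, Finset.mem_univ, true_and] at hj ⊢
      exact hj.1
    · have := h (Finset.mem_filter.2 ⟨Finset.mem_univ i, rfl⟩)
      simp [B] at this
  have hsplit : rank key i = W * rank id (loc i) + B.card := by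
    rw [← card_filter_lt_location loc id hW, rank, ← Finset.card_union_of_disjoint]
    · congr 1
      ext j
      simp only [B, Finset.mem_filter, Finset.mem_univ, true_and, Finset.mem_union]
      constructor
      · intro h
        rcases lt_trichotomy (id (loc j)) (id (loc i)) with h' | h' | h'
        · exact Or.inl h'
        · exact Or.inr ⟨hid h', h⟩
        · exact absurd (hs i j h') (not_le.2 h)
      · rintro (h | h)
        · refine lt_of_le_of_ne (hs j i h) fun he => ?_
          rw [hk he] at h
          exact lt_irrefl _ h
        · exact h.2
    · rw [Finset.disjoint_left]
      intro j hj hj'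
      simp only [B, Finset.mem_filter, Finset.mem_univ, true_and] at hj hj'
      rw [hj'.1] at hj
      exact lt_irrefl _ hj
  rw [hsplit, Nat.mul_add_div (by omega), Nat.div_eq_of_lt hB, add_zero]

end Locations

/-! ### Items and memories -/

/-- The items that are moved around by the routing algorithm: item number `idx` of the vertex with
identifier `src`, possibly with a token as payload, a position `pos` among the items with the same
destination, the identifier `home` of the vertex where the item has to go, and a mark. -/
structure Item (n c L : ℕ) where
  src : Fin (n ^ c)
  idx : Fin (2 * L)
  payload : Option (Token n c)
  pos : Fin (2 * L + 1)
  home : Fin (n ^ c)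
  mark : Bool

/-- A token as a pair. -/
def Token.equiv (n c : ℕ) : Token n c ≃ Fin (n ^ c) × Fin (n ^ c) where
  toFun z := (z.label, z.msg)
  invFun q := ⟨q.1, q.2⟩
  left_inv _ := rfl
  right_inv _ := rfl

instance (n c : ℕ) : Fintype (Token n c) := Fintype.ofEquiv _ (Token.equiv n c).symm

/-- An item as a tuple. -/
def Item.equiv (n c L : ℕ) : Item n c L ≃
    Fin (n ^ c) × Fin (2 * L) × Option (Token n c) × Fin (2 * L + 1) × Fin (n ^ c) × Bool where
  toFun z := (z.src, z.idx, z.payload, z.pos, z.home, z.mark)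
  invFun q := ⟨q.1, q.2.1, q.2.2.1, q.2.2.2.1, q.2.2.2.2.1, q.2.2.2.2.2⟩
  left_inv _ := rfl
  right_inv _ := rfl

instance (n c L : ℕ) : Fintype (Item n c L) := Fintype.ofEquiv _ (Item.equiv n c L).symm

/-- Source, index, payload (label and content), position and home contribute six factors `n ^ c`.
The five further factors `n` absorb the 2 in `2 * L`, the option, the two constants in `2 * L + 1`,
and the mark. -/
theorem Item.card_le {n c L : ℕ} (hn : 2 ≤ n) (hL : L ≤ n ^ c) :
    Fintype.card (Item n c L) ≤ n ^ (6 * c + 5) := by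
  have hpos : 1 ≤ n ^ c := Nat.one_le_pow _ _ (by omega)
  have h1 : 2 * L ≤ n * n ^ c := Nat.mul_le_mul hn hL
  have h2 : n ^ c * n ^ c + 1 ≤ n * (n ^ c * n ^ c) := by nlinarith [Nat.mul_le_mul hpos hpos]
  have h3 : 2 * L + 1 ≤ n * (n * n ^ c) := by nlinarith [Nat.mul_le_mul hn hpos]
  rw [Fintype.card_congr (Item.equiv n c L)]
  simp only [Fintype.card_prod, Fintype.card_fin, Fintype.card_option, Fintype.card_bool,
    Fintype.card_congr (Token.equiv n c)]
  calc _ ≤ n ^ c * ((n * n ^ c) * ((n * (n ^ c * n ^ c)) * ((n * (n * n ^ c)) * (n ^ c * n)))) := by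
        gcongr
    _ = n ^ (6 * c + 5) := by ring

/-- The local memory of a vertex: its identifier, a flag, and the items located at the vertex. -/
structure Mem (n c L : ℕ) where
  id : Fin (n ^ c)
  flag : Prop
  items : Multiset (Item n c L)

/-- The items have been sorted by `key`. -/
def SortStep {n c L : ℕ} {K : Type*} [LinearOrder K] (key : Item n c L → K)
    (X Y : Fin n → Mem n c L) : Prop :=
  Function.Injective (fun v => (X v).id) → (∀ v, (X v).items.card ≤ 2 * L) →
    (∀ v, (Y v).id = (X v).id ∧ (Y v).flag = (X v).flag) ∧
    ∑ v, (Y v).items = ∑ v, (X v).items ∧ (∀ v, (Y v).items.card ≤ 2 * L) ∧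
    ∀ v w, (X v).id < (X w).id → ∀ z ∈ (Y v).items, ∀ z' ∈ (Y w).items, key z ≤ key z'

/-- A whole item travels as the content of one token of the larger range. The token's label is the
rank of the item's key among all possible items, so keys from any linear order can be used. -/
theorem computes_sortStep {Δ c b n L T : ℕ} {φ : ℝ} {K : Type*} [LinearOrder K] (hn : 2 ≤ n)
    (hL : L ≤ n ^ c) (h : SortingSolvable Δ (6 * c + 5) b n φ (2 * L) T)
    (key : Item n c L → K) :
    Computes Δ b n φ T (SortStep key) := by
  classical
  have hcard := Item.card_le hn hL
  have hc : n ^ c ≤ n ^ (6 * c + 5) := Nat.pow_le_pow_right (by omega) (by omega)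
  obtain ⟨e⟩ : Nonempty (Item n c L ↪ Fin (n ^ (6 * c + 5))) :=
    Function.Embedding.nonempty_of_card_le (by simpa using hcard)
  let enc : Item n c L → Token n (6 * c + 5) := fun z =>
    ⟨⟨rank key z, (rank_lt_card key z).trans_le hcard⟩, e z⟩
  have henc : Function.Injective enc := fun z z' hz => e.injective (congrArg Token.msg hz)
  have hlabel : ∀ z z', (enc z).label ≤ (enc z').label ↔ key z ≤ key z' := fun z z' =>
    (not_lt.symm.trans (not_congr (rank_lt_rank key))).trans not_lt
  have h : Computes Δ b n φ T fun (x : Fin n → NodeInput n (6 * c + 5)) y =>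
    IsSortingInput (2 * L) x → IsSorted (2 * L) x y := h
  rcases isEmpty_or_nonempty (Item n c L) with hE | hE
  · refine Computes.mono (Computes.withMemory (M := Mem n c L) h (fun m => ⟨m.id.castLE hc, 0⟩)
      (fun m _ => m)) ?_
    rintro X Y ⟨y, -, rfl⟩ - hX
    exact ⟨fun _ => ⟨rfl, rfl⟩, rfl, hX, fun v w _ z => isEmptyElim z⟩
  let dec : Token n (6 * c + 5) → Item n c L := Function.invFun enc
  have hdec : ∀ z, dec (enc z) = z := Function.leftInverse_invFun henc
  refine Computes.mono (Computes.withMemory (M := Mem n c L) (M' := Mem n c L) h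
    (fun m => ⟨m.id.castLE hc, m.items.map enc⟩)
    (fun m y => ⟨m.id, m.flag, y.map dec⟩)) ?_
  rintro X Y ⟨y, hy, rfl⟩ hid hX
  obtain ⟨hsum, hle, hsort⟩ := hy ⟨fun v w hvw => hid (Fin.castLE_injective hc hvw), by simpa using hX⟩
  have hmap : ∀ y : Fin n → Multiset (Token n (6 * c + 5)),
      ∑ v, (y v).map dec = (∑ v, y v).map dec := fun y => by
    rw [← Multiset.coe_mapAddMonoidHom, map_sum]
  have hmem : ∀ v, ∀ t ∈ y v, ∃ z, t = enc z := by
    intro v t ht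
    have : t ∈ ∑ v, y v := Multiset.mem_sum.2 ⟨v, Finset.mem_univ v, ht⟩
    rw [hsum] at this
    obtain ⟨w, -, hw⟩ := Multiset.mem_sum.1 this
    obtain ⟨z, -, hz⟩ := Multiset.mem_map.1 hw
    exact ⟨z, hz.symm⟩
  refine ⟨fun _ => ⟨rfl, rfl⟩, ?_, ?_, ?_⟩
  · simp only
    rw [hmap, hsum, ← hmap]
    refine Finset.sum_congr rfl fun v _ => ?_
    rw [Multiset.map_map]
    simp [hdec]
  · simpa using hle
  · intro v w hvw z hz z' hz'
    obtain ⟨t, ht, rfl⟩ := Multiset.mem_map.1 hz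
    obtain ⟨t', ht', rfl⟩ := Multiset.mem_map.1 hz'
    have := hsort v w hvw t ht t' ht'
    obtain ⟨z, rfl⟩ := hmem v t ht
    obtain ⟨z', rfl⟩ := hmem w t' ht'
    rw [hdec, hdec]
    exact (hlabel z z').1 this

/-! ### Configurations -/

section Config

variable {n c L : ℕ} {K : Type*} [LinearOrder K]

/-- Vertex `v` has identifier `id v` and holds the `2 * L` items `f i` with `loc i = v`. -/
structure Config (id : Fin n → Fin (n ^ c)) (loc : Fin n × Fin (2 * L) → Fin n)
    (f : Fin n × Fin (2 * L) → Item n c L) (X : Fin n → Mem n c L) : Prop where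
  id_eq : ∀ v, (X v).id = id v
  items_eq : ∀ v, (X v).items = (Finset.univ.filter fun i => loc i = v).val.map f
  card_eq : ∀ v, (Finset.univ.filter fun i => loc i = v).card = 2 * L

variable {id : Fin n → Fin (n ^ c)} {loc : Fin n × Fin (2 * L) → Fin n}
  {f : Fin n × Fin (2 * L) → Item n c L} {X Y : Fin n → Mem n c L}

theorem Config.sum_items (h : Config id loc f X) :
    ∑ v, (X v).items = Finset.univ.val.map f := by
  classical
  have hs : ∀ s : Finset (Fin n × Fin (2 * L)), s.val.map f = ∑ i ∈ s, {f i} := fun s => by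
    rw [Finset.sum, ← Multiset.sum_map_singleton (s.val.map f), Multiset.map_map]
    rfl
  simp only [h.items_eq, hs]
  exact Finset.sum_fiberwise Finset.univ loc _

theorem Config.mem_items (h : Config id loc f X) {v : Fin n} {z : Item n c L} :
    z ∈ (X v).items ↔ ∃ i, loc i = v ∧ f i = z := by
  simp [h.items_eq]

theorem Config.countP_items (h : Config id loc f X) (v : Fin n) (p : Item n c L → Prop)
    [DecidablePred p] :
    (X v).items.countP p = (Finset.univ.filter fun i => loc i = v ∧ p (f i)).card := by
  rw [h.items_eq, Multiset.countP_map, ← Finset.filter_filter]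
  rfl

/-- Full load is preserved, and an injective key leaves no freedom: the location of each item is
determined by its rank. -/
theorem Config.sortStep (h : Config id loc f X) (hid : Function.Injective id)
    {key : Item n c L → K} (hk : Function.Injective (fun i => key (f i))) (hs : SortStep key X Y) :
    ∃ loc', Config id loc' f Y ∧ (∀ v, (Y v).flag = (X v).flag) ∧
      ∀ i, rank id (loc' i) = rank (fun i => key (f i)) i / (2 * L) := by
  obtain ⟨h1, hsum, hle, hsort⟩ := hs (by simpa only [h.id_eq] using hid)
    (fun v => by rw [h.items_eq, Multiset.card_map]; exact (h.card_eq v).le)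
  rw [h.sum_items] at hsum
  obtain ⟨loc', hloc'⟩ := exists_location (f := f) (fun i j hij => hk (congrArg key hij)) _ hsum
  have hcard := card_filter_location (W := 2 * L) (by simp) loc'
    (fun v => by
    have := hle v
    rwa [hloc', Multiset.card_map] at this)
  have hcfg : Config id loc' f Y := ⟨fun v => by rw [(h1 v).1, h.id_eq], hloc', hcard⟩
  refine ⟨loc', hcfg, fun v => (h1 v).2, rank_location loc' id hid hcard hk fun i j hij => ?_⟩
  exact hsort (loc' i) (loc' j) (by rwa [h.id_eq, h.id_eq]) _ (hcfg.mem_items.2 ⟨i, rfl, rfl⟩) _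
    (hcfg.mem_items.2 ⟨j, rfl, rfl⟩)

/-- A local change of the items. -/
def Mem.update (u : Mem n c L → Item n c L → Item n c L) (m : Mem n c L) : Mem n c L :=
  { m with items := m.items.map (u m) }

theorem Config.update (h : Config id loc f X) (u : Mem n c L → Item n c L → Item n c L) :
    Config id loc (fun i => u (X (loc i)) (f i)) (fun v => (X v).update u) where
  id_eq := h.id_eq
  items_eq v := by
    simp only [Mem.update, h.items_eq v, Multiset.map_map]
    refine Multiset.map_congr rfl fun i hi => ?_
    have : loc i = v := by simpa using hi
    simp [this]
  card_eq := h.card_eq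

end Config

/-! ### Sorting with two window offsets -/

section TwoWindows

variable {n c L : ℕ} {K : Type*} [LinearOrder K]

open scoped Classical in
/-- A flagged vertex marks its `L` smallest items. -/
noncomputable def markSmallest (key : Item n c L → K) (m : Mem n c L) (z : Item n c L) :
    Item n c L :=
  { z with mark := decide (m.flag ∧ m.items.countP (fun z' => key z' < key z) < L) }

/-- Sort the items by `key` and update them by `u` (in the context of the items at the same vertex);
then let the flagged vertices move their `L` smallest items to the end of the order, sort again,
and update again. -/
def TwoWindows (key : Item n c L → K) (u : Multiset (Item n c L) → Item n c L → Item n c L)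
    (X Z : Fin n → Mem n c L) : Prop :=
  ∃ Y₁, (∃ Y, SortStep key X Y ∧
      Y₁ = fun v => ((Y v).update fun m => u m.items).update (markSmallest key)) ∧
    ∃ Y₂, SortStep (fun z => toLex (z.mark, key z)) Y₁ Y₂ ∧
      Z = fun v => (Y₂ v).update fun m => u m.items

theorem computes_twoWindows {Δ b T : ℕ} {φ : ℝ} (hn : 2 ≤ n)
    (hL : L ≤ n ^ c) (h : SortingSolvable Δ (6 * c + 5) b n φ (2 * L) T)
    (key : Item n c L → K) (u : Multiset (Item n c L) → Item n c L → Item n c L) :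
    Computes Δ b n φ (T + T) (TwoWindows key u) :=
  Computes.comp
    ((computes_sortStep hn hL h key).withMemory (fun m => m)
      fun _ m => (m.update fun m => u m.items).update (markSmallest key))
    ((computes_sortStep hn hL h fun z => toLex (z.mark, key z)).withMemory (fun m => m)
      fun _ m => m.update fun m => u m.items)

/-- An element in the second half of its block has its `L` predecessors in the same block. The next
lemma shows that a shift by `L` moves an element from the first half of a block into a second half.
-/
theorem div_eq_div_of_le_mod {a b L : ℕ} (hL : 0 < L) (hab : a ≤ b) (hba : b ≤ a + L)
    (h : L ≤ b % (2 * L)) : a / (2 * L) = b / (2 * L) := by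
  have h1 := Nat.div_add_mod b (2 * L)
  have h2 := Nat.mod_lt b (show 0 < 2 * L by omega)
  have h3 : (b / (2 * L) + 1) * (2 * L) = 2 * L * (b / (2 * L)) + 2 * L := by ring
  have h4 : b / (2 * L) * (2 * L) = 2 * L * (b / (2 * L)) := by ring
  exact Nat.div_eq_of_lt_le (by omega) (by omega)

theorem sub_mod_two_mul {b L : ℕ} (hb : 2 * L ≤ b) (h : b % (2 * L) < L) :
    L ≤ (b - L) % (2 * L) := by
  have h1 := Nat.div_add_mod b (2 * L)
  obtain ⟨q, hq⟩ : ∃ q, b / (2 * L) = q + 1 :=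
    Nat.exists_eq_succ_of_ne_zero (Nat.div_pos hb (by omega)).ne'
  have h2 : b - L = 2 * L * q + (L + b % (2 * L)) := by
    rw [hq] at h1
    have : 2 * L * (q + 1) = 2 * L * q + 2 * L := by ring
    omega
  rw [h2, Nat.mul_add_mod, Nat.mod_eq_of_lt (by omega)]
  omega

variable {id : Fin n → Fin (n ^ c)} {loc : Fin n × Fin (2 * L) → Fin n}
  {f : Fin n × Fin (2 * L) → Item n c L} {X Z : Fin n → Mem n c L}

/-- Items of distance at most `L` in the order by `key` meet in one of the two windows. -/
theorem Config.twoWindows (h : Config id loc f X) (hid : Function.Injective id) (hL : 0 < L)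
    (hflag : ∀ v, (X v).flag ↔ rank id v = 0)
    {key : Item n c L → K} {u : Multiset (Item n c L) → Item n c L → Item n c L}
    (hk : Function.Injective fun i => key (f i)) (hu : ∀ M z, key (u M z) = key z)
    (hm : ∀ z b, key { z with mark := b } = key z) (hs : TwoWindows key u X Z) :
    ∃ (loc₁ loc₂ : Fin n × Fin (2 * L) → Fin n) (b : Fin n × Fin (2 * L) → Bool)
      (X₁ X₂ : Fin n → Mem n c L),
      Config id loc₁ f X₁ ∧
      Config id loc₂ (fun i => { u (X₁ (loc₁ i)).items (f i) with mark := b i }) X₂ ∧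
      Config id loc₂ (fun i => u (X₂ (loc₂ i)).items
        { u (X₁ (loc₁ i)).items (f i) with mark := b i }) Z ∧
      (∀ v, (Z v).flag ↔ rank id v = 0) ∧
      ∀ i, (∀ j, rank (fun i => key (f i)) j ≤ rank (fun i => key (f i)) i →
          rank (fun i => key (f i)) i ≤ rank (fun i => key (f i)) j + L → loc₁ j = loc₁ i) ∨
        (∀ j, rank (fun i => key (f i)) j ≤ rank (fun i => key (f i)) i →
          rank (fun i => key (f i)) i ≤ rank (fun i => key (f i)) j + L → loc₂ j = loc₂ i) := by
  classical
  obtain ⟨_, ⟨X₁, hs₁, rfl⟩, X₂, hs₂, rfl⟩ := hs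
  obtain ⟨loc₁, h₁, hf₁, hr₁⟩ := h.sortStep hid hk hs₁
  have h₁' := h₁.update fun m => u m.items
  set f₁ := fun i => u (X₁ (loc₁ i)).items (f i) with hf₁_def
  have hkf₁ : ∀ i, key (f₁ i) = key (f i) := fun i => hu _ _
  set b : Fin n × Fin (2 * L) → Bool := fun i =>
    (markSmallest key ((X₁ (loc₁ i)).update fun m => u m.items) (f₁ i)).mark with hb_def
  have h₁'' : Config id loc₁ (fun i => { f₁ i with mark := b i }) _ := h₁'.update (markSmallest key)
  set r := rank fun i => key (f i)
  have hloc : ∀ i j, r i < 2 * L → r j ≤ r i → loc₁ j = loc₁ i := fun i j hi hj => by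
    apply rank_injective hid
    rw [hr₁, hr₁, Nat.div_eq_of_lt hi, Nat.div_eq_of_lt (hj.trans_lt hi)]
  -- The first vertex holds exactly the ranks below `2 * L`, so counting there gives the global
  -- rank.
  have hb : ∀ i, b i = true ↔ r i < L := by
    intro i
    have h0 : b i = true ↔ (X₁ (loc₁ i)).flag ∧
        ((X₁ (loc₁ i)).update fun m => u m.items).items.countP
          (fun z' => key z' < key (f₁ i)) < L := by
      simp only [hb_def, markSmallest, decide_eq_true_eq]
      rfl
    have h2 : rank id (loc₁ i) = 0 ↔ r i < 2 * L := by
      rw [hr₁, Nat.div_eq_zero_iff]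
      constructor
      · rintro (h | h)
        · omega
        · exact h
      · exact Or.inr
    rw [h0, h₁'.countP_items, hf₁, hflag, h2]
    simp only [hkf₁]
    have h3 : r i < 2 * L → (Finset.univ.filter fun j => loc₁ j = loc₁ i ∧ key (f j) < key (f i)).card
        = r i := fun hi => by
      congr 1
      ext j
      simp only [Finset.mem_filter, Finset.mem_univ, true_and, and_iff_right_iff_imp]
      exact fun hj => hloc i j hi ((rank_lt_rank fun i => key (f i)).2 hj).le
    constructor
    · rintro ⟨hi, hc⟩
      rwa [h3 hi] at hc
    · intro hi
      have : r i < 2 * L := by omega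
      exact ⟨this, by rwa [h3 this]⟩
  have hk₂ : Function.Injective fun i => (fun z : Item n c L => toLex (z.mark, key z))
      { f₁ i with mark := b i } := by
    intro i j hij
    have := congrArg (fun q => (ofLex q).2) hij
    simp only [ofLex_toLex, hm, hkf₁] at this
    exact hk this
  obtain ⟨loc₂, h₂, hf₂, hr₂⟩ := h₁''.sortStep hid hk₂ hs₂
  simp only [hm, hkf₁] at hr₂
  have hr₂' : ∀ i, L ≤ r i → rank id (loc₂ i) = (r i - L) / (2 * L) := fun i hi => by
    rw [hr₂, rank_toLex_of_le hk b hb hi]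
  refine ⟨loc₁, loc₂, b, X₁, X₂, h₁, h₂, h₂.update fun m => u m.items, fun v => ?_, fun i => ?_⟩
  · rw [← hflag, ← hf₁]
    exact iff_of_eq (hf₂ v)
  · by_cases hi : r i < 2 * L
    · exact Or.inl fun j hj _ => hloc i j hi hj
    · by_cases hi' : L ≤ r i % (2 * L)
      · refine Or.inl fun j hj hij => rank_injective hid ?_
        rw [hr₁, hr₁]
        exact div_eq_div_of_le_mod hL hj hij hi'
      -- Here `r i ≥ 2 * L`, hence `r j ≥ L`: neither item was moved to the end, and both ranks drop
      -- by exactly `L`.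
      · refine Or.inr fun j hj hij => rank_injective hid ?_
        rw [hr₂' i (by omega), hr₂' j (by omega)]
        exact div_eq_div_of_le_mod hL (by omega) (by omega)
          (sub_mod_two_mul (by omega) (by omega))

end TwoWindows

/-! ### Positions among the items with the same destination -/

theorem rank_le_rank_add {ι K : Type*} [Fintype ι] [LinearOrder K] (key : ι → K) (i j : ι) :
    rank key i ≤ rank key j + (Finset.univ.filter fun l => key j ≤ key l ∧ key l < key i).card := by
  classical
  refine (Finset.card_le_card fun l hl => ?_).trans (Finset.card_union_le _ _)
  simp only [Finset.mem_filter, Finset.mem_univ, true_and, Finset.mem_union] at hl ⊢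
  exact (lt_or_ge (key l) (key j)).imp_right fun h => ⟨h, hl⟩

section Phases

variable {n c L : ℕ}

/-- The identity of an item. -/
def Item.ident (z : Item n c L) : Fin (n ^ c) ×ₗ Fin (2 * L) := toLex (z.src, z.idx)

/-- The destination of an item, `⊤` if it has no payload. -/
def Item.dest (z : Item n c L) : WithTop ℕ := z.payload.elim ⊤ fun t => ((t.label : ℕ) : WithTop ℕ)

/-- The order by destination. -/
def Item.destKey (z : Item n c L) : WithTop ℕ ×ₗ (Fin (n ^ c) ×ₗ Fin (2 * L)) :=
  toLex (z.dest, z.ident)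

open scoped Classical in
/-- Raise `pos` to the number of items in `M` with the same destination that precede `z`. -/
noncomputable def updatePos (M : Multiset (Item n c L)) (z : Item n c L) : Item n c L :=
  { z with
    pos := max z.pos ⟨min (M.countP fun z' => z'.dest = z.dest ∧ z'.destKey < z.destKey) (2 * L),
      Nat.lt_succ_of_le (min_le_right _ _)⟩ }

variable {id : Fin n → Fin (n ^ c)} {loc : Fin n × Fin (2 * L) → Fin n}
  {f : Fin n × Fin (2 * L) → Item n c L} {X Z : Fin n → Mem n c L}

/-- Items with the same proper destination are contiguous in the order and at most `L` in number, so
an item meets all its predecessors in the group in one of the windows. A local count never exceeds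
the true one, so the maximum of the two counts is correct. Items without payload may form a larger
group, but need no position. -/
theorem Config.positions (h : Config id loc f X) (hid : Function.Injective id) (hL : 0 < L)
    (hflag : ∀ v, (X v).flag ↔ rank id v = 0) (hpos : ∀ i, (f i).pos = 0)
    (hident : Function.Injective fun i => (f i).ident)
    (hdest : ∀ d : ℕ, (Finset.univ.filter fun i => (f i).dest = d).card ≤ L)
    (hs : TwoWindows Item.destKey updatePos X Z) :
    ∃ loc' f', Config id loc' f' Z ∧ (∀ v, (Z v).flag ↔ rank id v = 0) ∧
      (∀ i, (f' i).src = (f i).src ∧ (f' i).idx = (f i).idx ∧ (f' i).payload = (f i).payload ∧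
        (f' i).home = (f i).home) ∧
      ∀ i, (f i).dest ≠ ⊤ → ((f' i).pos : ℕ) =
        (Finset.univ.filter fun j => (f j).dest = (f i).dest ∧ (f j).destKey < (f i).destKey).card := by
  classical
  have hk : Function.Injective fun i => (f i).destKey := fun i j hij =>
    hident (congrArg (fun q => (ofLex q).2) hij)
  obtain ⟨loc₁, loc₂, b, X₁, X₂, h₁, h₂, h₃, hfl, hmeet⟩ :=
    h.twoWindows (u := updatePos) hid hL hflag hk (fun _ _ => rfl) (fun _ _ => rfl) hs
  refine ⟨loc₂, _, h₃, hfl, fun i => ⟨rfl, rfl, rfl, rfl⟩, fun i hi => ?_⟩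
  obtain ⟨d, hd'⟩ := WithTop.ne_top_iff_exists.1 hi
  have hd : ((d : ℕ) : WithTop ℕ) = (f i).dest := hd'
  have hle : ∀ loc' : Fin n × Fin (2 * L) → Fin n,
      (Finset.univ.filter fun j => loc' j = loc' i ∧ (f j).dest = (f i).dest ∧ (f j).destKey < (f i).destKey).card ≤
      (Finset.univ.filter fun j => (f j).dest = (f i).dest ∧ (f j).destKey < (f i).destKey).card :=
    fun loc' => Finset.card_le_card fun j hj => by
      simp only [Finset.mem_filter, Finset.mem_univ, true_and] at hj ⊢
      exact hj.2
  have hle' : (Finset.univ.filter fun j =>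
      (f j).dest = (f i).dest ∧ (f j).destKey < (f i).destKey).card ≤ 2 * L := by
    refine (Finset.card_le_card fun j hj => ?_).trans ((hdest d).trans (by omega))
    simp only [Finset.mem_filter, Finset.mem_univ, true_and] at hj ⊢
    rw [hj.1, hd]
  have hdist : ∀ j, (f j).dest = (f i).dest → (f j).destKey < (f i).destKey →
      rank (fun i => (f i).destKey) i ≤ rank (fun i => (f i).destKey) j + L := by
    intro j hj hji
    refine (rank_le_rank_add _ i j).trans (Nat.add_le_add_left ?_ _)
    refine (Finset.card_le_card fun l hl => ?_).trans (hdest d)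
    simp only [Finset.mem_filter, Finset.mem_univ, true_and] at hl ⊢
    have h1 : (f j).dest ≤ (f l).dest := Prod.Lex.monotone_fst _ _ hl.1
    have h2 : (f l).dest ≤ (f i).dest := Prod.Lex.monotone_fst _ _ hl.2.le
    rw [hj] at h1
    rw [hd]
    exact le_antisymm h2 h1
  have heq : ∀ loc' : Fin n × Fin (2 * L) → Fin n,
      (∀ j, rank (fun i => (f i).destKey) j ≤ rank (fun i => (f i).destKey) i →
        rank (fun i => (f i).destKey) i ≤ rank (fun i => (f i).destKey) j + L → loc' j = loc' i) →
      (Finset.univ.filter fun j => loc' j = loc' i ∧ (f j).dest = (f i).dest ∧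
        (f j).destKey < (f i).destKey).card =
      (Finset.univ.filter fun j => (f j).dest = (f i).dest ∧ (f j).destKey < (f i).destKey).card := by
    intro loc' hloc'
    congr 1
    ext j
    simp only [Finset.mem_filter, Finset.mem_univ, true_and, and_iff_right_iff_imp]
    rintro ⟨hj, hji⟩
    exact hloc' j ((rank_lt_rank fun i => (f i).destKey).2 hji).le (hdist j hj hji)
  have hval : (((updatePos (X₂ (loc₂ i)).items
      { updatePos (X₁ (loc₁ i)).items (f i) with mark := b i }).pos : Fin (2 * L + 1)) : ℕ) =
      max (max 0 (min (Finset.univ.filter fun j => loc₁ j = loc₁ i ∧ (f j).dest = (f i).dest ∧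
        (f j).destKey < (f i).destKey).card (2 * L)))
        (min (Finset.univ.filter fun j => loc₂ j = loc₂ i ∧ (f j).dest = (f i).dest ∧
        (f j).destKey < (f i).destKey).card (2 * L)) := by
    rw [← h₁.countP_items (loc₁ i) fun z => z.dest = (f i).dest ∧ z.destKey < (f i).destKey]
    have := h₂.countP_items (loc₂ i) fun z => z.dest = (f i).dest ∧ z.destKey < (f i).destKey
    refine Eq.trans ?_ (congrArg (fun q => max _ (min q (2 * L))) this)
    have h0 := hpos i
    simp only [updatePos, Fin.coe_max, h0]
    rfl
  rw [hval]
  have a1 := hle loc₁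
  have a2 := hle loc₂
  rcases hmeet i with hm | hm
  · have := heq loc₁ hm
    omega
  · have := heq loc₂ hm
    omega

/-! ### Matching the payloads with slots at their destinations -/

/-- `z` carries a token with destination `z'.src`, and `z'` is the slot reserved for it there. -/
def Item.FitsInto (z z' : Item n c L) : Prop :=
  (∃ t, z.payload = some t ∧ t.label = z'.src) ∧ z'.payload = none ∧ (z.pos : ℕ) + L = z'.idx

/-- One of `z` and `z'` fits into the other. -/
def Item.Partner (z z' : Item n c L) : Prop := z.FitsInto z' ∨ z'.FitsInto z

/-- Payloads and slots in an order in which partners are neighbors. -/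
def Item.slot (z : Item n c L) : WithTop (ℕ ×ₗ ℕ) :=
  z.payload.elim
    (if L ≤ z.idx then ((toLex ((z.src : ℕ), 2 * ((z.idx : ℕ) - L) + 1) : ℕ ×ₗ ℕ) : WithTop _) else ⊤)
    fun t => ((toLex ((t.label : ℕ), 2 * (z.pos : ℕ)) : ℕ ×ₗ ℕ) : WithTop _)

/-- The order by slots. -/
def Item.slotKey (z : Item n c L) : WithTop (ℕ ×ₗ ℕ) ×ₗ (Fin (n ^ c) ×ₗ Fin (2 * L)) :=
  toLex (z.slot, z.ident)

open scoped Classical in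
/-- Send an item to the vertex from which its partner came. -/
noncomputable def updateHome (M : Multiset (Item n c L)) (z : Item n c L) : Item n c L :=
  { z with home := if h : ∃ z' ∈ M, z.Partner z' then h.choose.src else z.home }

theorem updateHome_home_of_forall {M : Multiset (Item n c L)} {z : Item n c L} {s : Fin (n ^ c)}
    (h : ∀ z' ∈ M, z.Partner z' → z'.src = s) (h' : (∃ z' ∈ M, z.Partner z') ∨ z.home = s) :
    (updateHome M z).home = s := by
  simp only [updateHome]
  split_ifs with hM
  · exact h _ hM.choose_spec.1 hM.choose_spec.2
  · exact h'.resolve_left hM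

theorem eq_of_src_of_idx (hident : Function.Injective fun i => (f i).ident)
    {i j : Fin n × Fin (2 * L)} (h1 : (f i).src = (f j).src)
    (h2 : ((f i).idx : ℕ) = (f j).idx) : i = j :=
  hident (congrArg toLex (Prod.ext h1 (Fin.ext h2)))

/-- For each destination, tokens get the even numbers `2 * pos` and slots the odd numbers `2 * (idx
- L) + 1`, so a slot directly follows the token that fits into it; unused padding is sorted to `⊤`.
-/
theorem rank_slotKey_of_fitsInto (hident : Function.Injective fun i => (f i).ident)
    (huniq : ∀ i j t t', (f i).payload = some t → (f j).payload = some t' → t.label = t'.label →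
      (f i).pos = (f j).pos → i = j)
    {i j : Fin n × Fin (2 * L)} (h : (f i).FitsInto (f j)) :
    rank (fun i => (f i).slotKey) i ≤ rank (fun i => (f i).slotKey) j ∧
      rank (fun i => (f i).slotKey) j ≤ rank (fun i => (f i).slotKey) i + 1 := by
  obtain ⟨⟨t, ht, htj⟩, hj, hij⟩ := h
  have hsi : (f i).slot = ((toLex ((t.label : ℕ), 2 * ((f i).pos : ℕ)) : ℕ ×ₗ ℕ) : WithTop _) := by
    simp [Item.slot, ht]
  have hsj : (f j).slot =
      ((toLex ((t.label : ℕ), 2 * ((f i).pos : ℕ) + 1) : ℕ ×ₗ ℕ) : WithTop _) := by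
    have h1 : L ≤ (f j).idx := by omega
    have h2 : ((f j).idx : ℕ) - L = (f i).pos := by omega
    simp [Item.slot, hj, h1, h2, htj]
  have hlt : (f i).slotKey < (f j).slotKey := by
    simp only [Item.slotKey, hsi, hsj, Prod.Lex.toLex_lt_toLex, WithTop.coe_lt_coe]
    simp
  have hbetween : ∀ l, (f i).slotKey ≤ (f l).slotKey → (f l).slotKey < (f j).slotKey → l = i := by
    intro l hil hlj
    have h1 : (f i).slot ≤ (f l).slot := Prod.Lex.monotone_fst _ _ hil
    have h2 : (f l).slot ≤ (f j).slot := Prod.Lex.monotone_fst _ _ hlj.le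
    rw [hsi] at h1
    rw [hsj] at h2
    rcases hl : (f l).payload with _ | t'
    · by_cases hlL : L ≤ (f l).idx
      · have hsl : (f l).slot =
            ((toLex (((f l).src : ℕ), 2 * (((f l).idx : ℕ) - L) + 1) : ℕ ×ₗ ℕ) : WithTop _) := by
          simp [Item.slot, hl, hlL]
        rw [hsl, WithTop.coe_le_coe, Prod.Lex.toLex_le_toLex] at h1 h2
        dsimp only at h1 h2
        have hlj' : l = j :=
          eq_of_src_of_idx hident (Fin.ext (by rw [← htj]; omega)) (by omega)
        rw [hlj'] at hlj
        exact absurd hlj (lt_irrefl _)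
      · have hsl : (f l).slot = ⊤ := by simp [Item.slot, hl, hlL]
        rw [hsl] at h2
        exact absurd h2 (not_le.2 (WithTop.coe_lt_top _))
    · have hsl : (f l).slot =
          ((toLex ((t'.label : ℕ), 2 * ((f l).pos : ℕ)) : ℕ ×ₗ ℕ) : WithTop _) := by
        simp [Item.slot, hl]
      rw [hsl, WithTop.coe_le_coe, Prod.Lex.toLex_le_toLex] at h1 h2
      dsimp only at h1 h2
      exact huniq l i t' t hl ht (Fin.ext (by omega)) (Fin.ext (by omega))
  refine ⟨((rank_lt_rank fun i => (f i).slotKey).2 hlt).le,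
    (rank_le_rank_add _ j i).trans (Nat.add_le_add_left ?_ _)⟩
  rw [← Finset.card_singleton i]
  refine Finset.card_le_card fun l hl => ?_
  simp only [Finset.mem_filter, Finset.mem_univ, true_and] at hl
  exact Finset.mem_singleton.2 (hbetween l hl.1 hl.2)

/-- The presence of a payload decides the direction of the match. A token determines the source and
index of its slot; a slot determines the destination and position of its token. -/
theorem partner_unique (hident : Function.Injective fun i => (f i).ident)
    (huniq : ∀ i j t t', (f i).payload = some t → (f j).payload = some t' → t.label = t'.label →
      (f i).pos = (f j).pos → i = j)
    {i j j' : Fin n × Fin (2 * L)} (h : (f i).Partner (f j)) (h' : (f i).Partner (f j')) :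
    j' = j := by
  rcases h with (⟨⟨t, h1, h2⟩, h3, h4⟩ | ⟨⟨t, h1, h2⟩, h3, h4⟩) <;>
    rcases h' with (⟨⟨t', h1', h2'⟩, h3', h4'⟩ | ⟨⟨t', h1', h2'⟩, h3', h4'⟩)
  · rw [h1, Option.some_inj] at h1'
    subst h1'
    exact eq_of_src_of_idx hident (h2'.symm.trans h2) (by omega)
  · rw [h1] at h3'
    cases h3'
  · rw [h1'] at h3
    cases h3
  · exact huniq _ _ t' t h1' h1 (h2'.trans h2.symm) (Fin.ext (by omega))

/-- Partners have rank distance at most `1 ≤ L`, so they meet in some window. Uniqueness makes the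
choice in `updateHome` harmless, and a window without the partner leaves the home untouched, so the
two updates cannot conflict. -/
theorem Config.matching (h : Config id loc f X) (hid : Function.Injective id) (hL : 0 < L)
    (hflag : ∀ v, (X v).flag ↔ rank id v = 0)
    (hident : Function.Injective fun i => (f i).ident)
    (huniq : ∀ i j t t', (f i).payload = some t → (f j).payload = some t' → t.label = t'.label →
      (f i).pos = (f j).pos → i = j)
    (hhome : ∀ i, (f i).home = (f i).src)
    (hs : TwoWindows Item.slotKey updateHome X Z) :
    ∃ loc' f', Config id loc' f' Z ∧
      (∀ i, (f' i).src = (f i).src ∧ (f' i).idx = (f i).idx ∧ (f' i).payload = (f i).payload) ∧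
      (∀ i j, (f i).Partner (f j) → (f' i).home = (f j).src) ∧
      ∀ i, (∀ j, ¬ (f i).Partner (f j)) → (f' i).home = (f i).src := by
  classical
  have hk : Function.Injective fun i => (f i).slotKey := fun i j hij =>
    hident (congrArg (fun q => (ofLex q).2) hij)
  obtain ⟨loc₁, loc₂, b, X₁, X₂, h₁, h₂, h₃, -, hmeet⟩ :=
    h.twoWindows (u := updateHome) hid hL hflag hk (fun _ _ => rfl) (fun _ _ => rfl) hs
  have hfits : ∀ i j, (f i).FitsInto (f j) → loc₁ i = loc₁ j ∨ loc₂ i = loc₂ j := fun i j hij => by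
    obtain ⟨hle, hdist⟩ := rank_slotKey_of_fitsInto hident huniq hij
    exact (hmeet j).imp (fun h => h i hle (by omega)) (fun h => h i hle (by omega))
  have hpartner : ∀ i j, (f i).Partner (f j) → loc₁ j = loc₁ i ∨ loc₂ j = loc₂ i := by
    rintro i j (h | h)
    · exact (hfits i j h).imp Eq.symm Eq.symm
    · exact hfits j i h
  obtain ⟨g, hg⟩ : ∃ g : Fin n × Fin (2 * L) → Item n c L,
      ∀ i, { updateHome (X₁ (loc₁ i)).items (f i) with mark := b i } = g i := ⟨_, fun _ => rfl⟩
  have hg' : ∀ i, (g i).src = (f i).src ∧ (g i).idx = (f i).idx ∧ (g i).payload = (f i).payload ∧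
      (g i).pos = (f i).pos ∧ (g i).home = (updateHome (X₁ (loc₁ i)).items (f i)).home := fun i => by
    rw [← hg]
    exact ⟨rfl, rfl, rfl, rfl, rfl⟩
  simp only [hg] at h₂ h₃
  have hP : ∀ i j, (g i).Partner (g j) ↔ (f i).Partner (f j) := fun i j => by
    simp only [Item.Partner, Item.FitsInto, hg']
  refine ⟨loc₂, _, h₃, fun i => ⟨(hg' i).1, (hg' i).2.1, (hg' i).2.2.1⟩, fun i j hij => ?_,
    fun i hi => ?_⟩
  · refine updateHome_home_of_forall (fun z' hz' hzz' => ?_) ?_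
    · obtain ⟨j', hj', rfl⟩ := h₂.mem_items.1 hz'
      rw [partner_unique hident huniq hij ((hP i j').1 hzz'), (hg' j).1]
    · rcases hpartner i j hij with hl | hl
      · rw [(hg' i).2.2.2.2]
        refine Or.inr (updateHome_home_of_forall (fun z' hz' hzz' => ?_) (Or.inl
          ⟨f j, h₁.mem_items.2 ⟨j, hl, rfl⟩, hij⟩))
        obtain ⟨j', hj', rfl⟩ := h₁.mem_items.1 hz'
        rw [partner_unique hident huniq hij hzz']
      · exact Or.inl ⟨g j, h₂.mem_items.2 ⟨j, hl, rfl⟩, (hP i j).2 hij⟩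
  · refine updateHome_home_of_forall (fun z' hz' hzz' => ?_) (Or.inr ?_)
    · obtain ⟨j', hj', rfl⟩ := h₂.mem_items.1 hz'
      exact absurd ((hP i j').1 hzz') (hi j')
    · rw [(hg' i).2.2.2.2]
      refine updateHome_home_of_forall (fun z' hz' hzz' => ?_) (Or.inr (hhome i))
      obtain ⟨j', hj', rfl⟩ := h₁.mem_items.1 hz'
      exact absurd hzz' (hi j')

end Phases

/-! ### The routing algorithm -/

section Routing

variable {n c L : ℕ}

/-- The items of a vertex: its tokens are the payloads of its first items. -/
noncomputable def initItem (L : ℕ) (x : NodeInput n c) (a : Fin (2 * L)) : Item n c L :=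
  ⟨x.id, a, x.tokens.toList[(a : ℕ)]?, 0, x.id, false⟩

/-- The initial memory of a vertex. -/
noncomputable def initMem (L : ℕ) (x : NodeInput n c) : Mem n c L :=
  ⟨x.id, False, Finset.univ.val.map (initItem L x)⟩

/-- The order in which the first items of the vertices come first. -/
def Item.leaderKey (z : Item n c L) : Fin (2 * L) ×ₗ Fin (n ^ c) := toLex (z.idx, z.src)

/-- The order by the identifiers of the vertices where the items have to go. -/
def Item.homeKey (z : Item n c L) : Fin (n ^ c) ×ₗ (Fin (n ^ c) ×ₗ Fin (2 * L)) :=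
  toLex (z.home, z.ident)

/-- A vertex is flagged if it holds its own first item. -/
def Mem.setFlag (m : Mem n c L) : Mem n c L :=
  { m with flag := ∃ z ∈ m.items, (z.idx : ℕ) = 0 ∧ z.src = m.id }

/-- The payload of an item, as a multiset. -/
def Item.tokens (z : Item n c L) : Multiset (Token n c) := z.payload.elim 0 fun t => {t}

/-- The local output: all payloads at the vertex. -/
def Mem.output (m : Mem n c L) : Multiset (Token n c) := (m.items.map Item.tokens).sum

theorem Item.mem_tokens {z : Item n c L} {t : Token n c} : t ∈ z.tokens ↔ z.payload = some t := by
  rcases h : z.payload with _ | t'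
  · simp [Item.tokens, h]
  · simp [Item.tokens, h, eq_comm]

theorem sum_getElem?_elim {α : Type*} (l : List α) (W : ℕ) (h : l.length ≤ W) :
    ∑ a : Fin W, (l[(a : ℕ)]?).elim (0 : Multiset α) (fun t => {t}) = (l : Multiset α) := by
  induction W generalizing l with
  | zero =>
    have : l = [] := List.length_eq_zero_iff.1 (by omega)
    simp [this]
  | succ W ih =>
    rcases l with _ | ⟨x, l⟩
    · simp
    · rw [Fin.sum_univ_succ]
      have := ih l (by simpa using h)
      simp only [Fin.val_succ, List.getElem?_cons_succ, this]
      simp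

theorem sum_tokens_initItem {x : NodeInput n c} (h : x.tokens.card ≤ L) :
    ∑ a, (initItem L x a).tokens = x.tokens := by
  refine (sum_getElem?_elim x.tokens.toList (2 * L) ?_).trans (Multiset.coe_toList _)
  rw [Multiset.length_toList]
  omega

theorem lt_of_payload_initItem {x : NodeInput n c} (h : x.tokens.card ≤ L) {a : Fin (2 * L)}
    {t : Token n c} (ha : (initItem L x a).payload = some t) : (a : ℕ) < L := by
  obtain ⟨h', -⟩ := List.getElem?_eq_some_iff.1 ha
  rw [Multiset.length_toList] at h'
  omega

theorem config_init (x : Fin n → NodeInput n c) :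
    Config (fun v => (x v).id) Prod.fst (fun i => initItem L (x i.1) i.2)
      fun v => initMem L (x v) := by
  have hf : ∀ v : Fin n, (Finset.univ.filter fun i : Fin n × Fin (2 * L) => i.1 = v) =
      Finset.univ.map ⟨fun a => (v, a), Prod.mk_right_injective v⟩ := fun v => by
    ext ⟨w, a⟩
    simp [eq_comm]
  refine ⟨fun v => rfl, fun v => ?_, fun v => ?_⟩
  · rw [hf, Finset.map_val, Multiset.map_map]
    rfl
  · rw [hf, Finset.card_map, Finset.card_univ, Fintype.card_fin]

/-- Only items with index `0` can precede, one per vertex of smaller identifier. -/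
theorem rank_leaderKey {x : Fin n → NodeInput n c} (v : Fin n) {a : Fin (2 * L)}
    (ha : (a : ℕ) = 0) :
    rank (fun i : Fin n × Fin (2 * L) => (initItem L (x i.1) i.2).leaderKey) (v, a) =
      rank (fun v => (x v).id) v := by
  classical
  rw [rank, rank, ← Finset.card_map (s := Finset.univ.filter fun w => (x w).id < (x v).id)
    ⟨fun w => (w, a), Prod.mk_left_injective _⟩]
  refine congrArg Finset.card (Finset.ext fun ⟨w, a'⟩ => ?_)
  simp only [Item.leaderKey, initItem, Prod.Lex.toLex_lt_toLex, Finset.mem_filter, Finset.mem_univ,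
    true_and, Finset.mem_map, Function.Embedding.coeFn_mk, Prod.mk.injEq]
  constructor
  · rintro (h | ⟨h1, h2⟩)
    · rw [Fin.lt_def] at h
      omega
    · exact ⟨w, h2, rfl, h1.symm⟩
  · rintro ⟨w', h1, rfl, h3⟩
    exact Or.inr ⟨h3.symm, h1⟩

/-- After sorting by `leaderKey`, exactly the vertex with the smallest identifier is flagged. -/
theorem config_setFlag {x : Fin n → NodeInput n c} (hid : Function.Injective fun v => (x v).id)
    (hL : 0 < L) {Y : Fin n → Mem n c L}
    (hs : SortStep Item.leaderKey (fun v => initMem L (x v)) Y) :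
    ∃ loc, Config (fun v => (x v).id) loc (fun i => initItem L (x i.1) i.2)
        (fun v => (Y v).setFlag) ∧
      ∀ v, (Y v).setFlag.flag ↔ rank (fun v => (x v).id) v = 0 := by
  have hk : Function.Injective fun i : Fin n × Fin (2 * L) =>
      (initItem L (x i.1) i.2).leaderKey := by
    rintro ⟨v, a⟩ ⟨w, a'⟩ h
    have h' := toLex.injective h
    rw [Prod.ext_iff] at h'
    exact Prod.ext (hid h'.2) h'.1
  obtain ⟨loc, h, -, hr⟩ := (config_init x).sortStep hid hk hs
  refine ⟨loc, ⟨h.id_eq, h.items_eq, h.card_eq⟩, fun v => ?_⟩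
  constructor
  · rintro ⟨z, hz, h0, hsrc⟩
    obtain ⟨⟨w, a⟩, hw, rfl⟩ := h.mem_items.1 hz
    rw [h.id_eq] at hsrc
    obtain rfl : w = v := hid hsrc
    have h1 := hr (w, a)
    rw [hw, rank_leaderKey (a := a) w h0] at h1
    by_contra hne
    -- Among ranks, `0` is the only fixed point of division by `2 * L`.
    exact absurd h1 (Nat.div_lt_self (Nat.pos_of_ne_zero hne) (by omega)).ne'
  · intro h0
    have h1 := hr (v, ⟨0, by omega⟩)
    rw [rank_leaderKey v rfl, h0, Nat.zero_div] at h1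
    replace h1 := h1.trans h0.symm
    exact ⟨_, h.mem_items.2 ⟨_, rank_injective hid h1, rfl⟩, rfl, (h.id_eq v).symm⟩

variable {loc : Fin n × Fin (2 * L) → Fin n} {f : Fin n × Fin (2 * L) → Item n c L}
  {X Y : Fin n → Mem n c L}

theorem Config.output {id : Fin n → Fin (n ^ c)} (h : Config id loc f X) (v : Fin n) :
    (X v).output = ∑ i with loc i = v, (f i).tokens := by
  rw [Mem.output, h.items_eq, Multiset.map_map]
  rfl

/-- If the homes are a permutation of the sources, then sorting by `homeKey` brings every item to its
home. -/
theorem Config.sort_home {id : Fin n → Fin (n ^ c)} (h : Config id loc f X)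
    (hid : Function.Injective id) (hident : Function.Injective fun i => (f i).ident)
    (σ : Equiv.Perm (Fin n × Fin (2 * L))) (hσ : ∀ i, (f i).home = id (σ i).1)
    (hs : SortStep Item.homeKey X Y) : Config id (fun i => (σ i).1) f Y := by
  have hk : Function.Injective fun i => (f i).homeKey := fun i j hij =>
    hident (congrArg (fun q => (ofLex q).2) hij)
  obtain ⟨loc', h', -, hr⟩ := h.sortStep hid hk hs
  have hcard : ∀ v, (Finset.univ.filter fun i => (σ i).1 = v).card = 2 * L := fun v => by
    have : (Finset.univ.filter fun i => (σ i).1 = v).map σ.toEmbedding =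
        Finset.univ.map ⟨fun a => (v, a), Prod.mk_right_injective v⟩ := by
      ext ⟨w, a⟩
      simp [Finset.mem_map_equiv, eq_comm]
    rw [← Finset.card_map σ.toEmbedding, this, Finset.card_map, Finset.card_univ, Fintype.card_fin]
  have hr' := rank_location (fun i => (σ i).1) id hid hcard hk fun i j hij => by
    refine (Prod.Lex.toLex_lt_toLex.2 (Or.inl ?_)).le
    rwa [hσ, hσ]
  have : loc' = fun i => (σ i).1 := funext fun i => rank_injective hid ((hr i).trans (hr' i).symm)
  rwa [← this]

/-- The whole computation. -/
def RoutingSteps (L : ℕ) (x : Fin n → NodeInput n c) (y : Fin n → Multiset (Token n c)) : Prop :=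
  ∃ X₃, (∃ X₂, (∃ X₁, (∃ Y, SortStep Item.leaderKey (fun v => initMem L (x v)) Y ∧
    X₁ = fun v => (Y v).setFlag) ∧
    TwoWindows Item.destKey updatePos X₁ X₂) ∧ TwoWindows Item.slotKey updateHome X₂ X₃) ∧
    ∃ Z, SortStep Item.homeKey X₃ Z ∧ y = fun v => (Z v).output

theorem computes_routingSteps {Δ b T : ℕ} {φ : ℝ} (hn : 2 ≤ n) (hL : L ≤ n ^ c)
    (h : SortingSolvable Δ (6 * c + 5) b n φ (2 * L) T) :
    Computes Δ b n φ (T + ((T + T) + ((T + T) + T))) (RoutingSteps (n := n) (c := c) L) :=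
  Computes.comp (Computes.comp (Computes.comp
    ((computes_sortStep hn hL h Item.leaderKey).withMemory (initMem L) fun _ m => m.setFlag)
    (computes_twoWindows hn hL h Item.destKey updatePos))
    (computes_twoWindows hn hL h Item.slotKey updateHome))
    ((computes_sortStep hn hL h Item.homeKey).withMemory (fun m => m) fun _ m => m.output)

/-- Partnership is symmetric and unique, so exchanging partners and fixing all other items is an
involution. Tokens whose destination is no vertex's identifier are among the fixed items. -/
theorem exists_perm_partner (hident : Function.Injective fun i => (f i).ident)
    (huniq : ∀ i j t t', (f i).payload = some t → (f j).payload = some t' → t.label = t'.label →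
      (f i).pos = (f j).pos → i = j) :
    ∃ σ : Equiv.Perm (Fin n × Fin (2 * L)), (∀ i j, (f i).Partner (f j) → σ i = j) ∧
      ∀ i, (∀ j, ¬ (f i).Partner (f j)) → σ i = i := by
  classical
  let s : Fin n × Fin (2 * L) → Fin n × Fin (2 * L) := fun i =>
    if h : ∃ j, (f i).Partner (f j) then h.choose else i
  have h1 : ∀ i j, (f i).Partner (f j) → s i = j := fun i j hij => by
    have h : ∃ j, (f i).Partner (f j) := ⟨j, hij⟩
    simp only [s, dif_pos h]
    exact partner_unique hident huniq hij h.choose_spec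
  have h2 : ∀ i, (∀ j, ¬ (f i).Partner (f j)) → s i = i := fun i hi => by
    simp only [s, dif_neg (not_exists.2 hi)]
  have hs : Function.Involutive s := fun i => by
    by_cases h : ∃ j, (f i).Partner (f j)
    · obtain ⟨j, hij⟩ := h
      rw [h1 i j hij]
      exact h1 j i (Or.symm hij)
    · rw [h2 i (not_exists.1 h), h2 i (not_exists.1 h)]
  exact ⟨hs.toPerm, h1, h2⟩

theorem isRouted_of_routingSteps (hL : 0 < L) {x : Fin n → NodeInput n c}
    {y : Fin n → Multiset (Token n c)} (hx : IsRoutingInput L x) (h : RoutingSteps L x y) :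
    IsRouted x y := by
  classical
  obtain ⟨hid, hload, hdst⟩ := hx
  obtain ⟨X₃, ⟨X₂, ⟨_, ⟨Y, hsY, rfl⟩, hs₂⟩, hs₃⟩, Z, hsZ, rfl⟩ := h
  obtain ⟨loc₁, h₁, hflag₁⟩ := config_setFlag hid hL hsY
  set f := fun i : Fin n × Fin (2 * L) => initItem L (x i.1) i.2
  have htok : ∑ i, (f i).tokens = ∑ v, (x v).tokens := by
    rw [Fintype.sum_prod_type]
    exact Finset.sum_congr rfl fun v _ => sum_tokens_initItem (hload v)
  have hident : Function.Injective fun i => (f i).ident := by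
    rintro ⟨v, a⟩ ⟨w, a'⟩ h
    have h' := toLex.injective h
    rw [Prod.ext_iff] at h'
    exact Prod.ext (hid h'.1) h'.2
  have hdest : ∀ d : ℕ, (Finset.univ.filter fun i => (f i).dest = d).card ≤ L := by
    intro d
    rcases (Finset.univ.filter fun i => (f i).dest = d).eq_empty_or_nonempty with he | ⟨i, hi⟩
    · simp [he]
    · have hd : (f i).dest = d := by simpa using hi
      rcases ht : (f i).payload with _ | t
      · simp [Item.dest, ht] at hd
      · have htd : (t.label : ℕ) = d := by
          simpa [Item.dest, ht] using hd
        refine le_trans ?_ (hdst t.label)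
        rw [← htok, ← Multiset.coe_countPAddMonoidHom, map_sum, Finset.card_filter]
        refine Finset.sum_le_sum fun j _ => ?_
        split_ifs with hj
        · rcases ht' : (f j).payload with _ | t'
          · simp [Item.dest, ht'] at hj
          · have : t'.label = t.label := Fin.ext (by
              rw [htd]
              simpa [Item.dest, ht'] using hj)
            exact Multiset.countP_pos.2 ⟨t', Item.mem_tokens.2 ht', this⟩
        · exact Nat.zero_le _
  obtain ⟨loc₂, g, h₂, hflag₂, hg, hpos⟩ :=
    h₁.positions hid hL hflag₁ (fun _ => rfl) hident hdest hs₂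
  have hident₂ : Function.Injective fun i => (g i).ident := by
    simpa only [Item.ident, hg] using hident
  have hk : Function.Injective fun i => (f i).destKey := fun i j hij =>
    hident (congrArg (fun q => (ofLex q).2) hij)
  have hposlt : ∀ i j, (f i).dest ≠ ⊤ → (f i).dest = (f j).dest →
      (f i).destKey < (f j).destKey → ((g i).pos : ℕ) < (g j).pos := by
    intro i j hi hij hlt
    rw [hpos i hi, hpos j (hij ▸ hi)]
    refine Finset.card_lt_card ⟨fun l hl => ?_, fun hsub => ?_⟩
    · simp only [Finset.mem_filter, Finset.mem_univ, true_and] at hl ⊢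
      exact ⟨hl.1.trans hij, hl.2.trans hlt⟩
    · have := hsub (Finset.mem_filter.2 ⟨Finset.mem_univ i, hij, hlt⟩)
      simp at this
  have huniq : ∀ i j t t', (g i).payload = some t → (g j).payload = some t' → t.label = t'.label →
      (g i).pos = (g j).pos → i = j := by
    intro i j t t' hi hj htt hp
    rw [(hg _).2.2.1] at hi hj
    have hi' : (f i).dest = ((t.label : ℕ) : WithTop ℕ) := by simp [Item.dest, hi]
    have hj' : (f j).dest = ((t.label : ℕ) : WithTop ℕ) := by simp [Item.dest, hj, htt]
    rcases lt_trichotomy (f i).destKey (f j).destKey with h | h | h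
    · have := hposlt i j (by simp [hi']) (hi'.trans hj'.symm) h
      rw [hp] at this
      exact absurd this (lt_irrefl _)
    · exact hk h
    · have := hposlt j i (by simp [hj']) (hj'.trans hi'.symm) h
      rw [hp] at this
      exact absurd this (lt_irrefl _)
  obtain ⟨loc₃, e, h₃, he, hpart, hnopart⟩ := h₂.matching hid hL hflag₂ hident₂ huniq
    (fun i => by rw [(hg i).2.2.2, (hg i).1]; rfl) hs₃
  obtain ⟨σ, hσ, hσ'⟩ := exists_perm_partner hident₂ huniq
  have hsrc : ∀ i, (g i).src = (x i.1).id := fun i => (hg i).1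
  have hhome : ∀ i, (e i).home = (x (σ i).1).id := by
    intro i
    by_cases hi : ∃ j, (g i).Partner (g j)
    · obtain ⟨j, hij⟩ := hi
      rw [hpart i j hij, hσ i j hij, hsrc]
    · rw [hnopart i (not_exists.1 hi), hσ' i (not_exists.1 hi), hsrc]
  have hident₃ : Function.Injective fun i => (e i).ident := by
    simpa only [Item.ident, he] using hident₂
  have h₄ := h₃.sort_home hid hident₃ σ hhome hsZ
  have htok' : ∀ i, (e i).tokens = (f i).tokens := fun i => by
    rw [Item.tokens, Item.tokens, (he i).2.2, (hg i).2.2.1]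
  constructor
  · simp only [h₄.output, htok', ← htok]
    exact Finset.sum_fiberwise Finset.univ (fun i => (σ i).1) fun i => (f i).tokens
  · intro u v t ht htv
    change t ∈ (Z u).output at ht
    rw [h₄.output, Multiset.mem_sum] at ht
    obtain ⟨i, hi, hti⟩ := ht
    rw [htok', Item.mem_tokens] at hti
    have hiu : (σ i).1 = u := by simpa using hi
    have hdi : (f i).dest = ((t.label : ℕ) : WithTop ℕ) := by simp [Item.dest, hti]
    -- The token is not its own predecessor, so its position is strictly below the size of its
    -- group. Therefore the index `pos + L` is a valid slot.
    have hlt : ((g i).pos : ℕ) < L := by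
      rw [hpos i (by simp [hdi])]
      refine lt_of_lt_of_le (Finset.card_lt_card ⟨fun l hl => ?_, fun hsub => ?_⟩) (hdest t.label)
      · simp only [Finset.mem_filter, Finset.mem_univ, true_and] at hl ⊢
        exact hl.1.trans hdi
      · have := hsub (Finset.mem_filter.2 ⟨Finset.mem_univ i, hdi⟩)
        simp at this
    have hslot : (g i).Partner (g (v, ⟨(g i).pos + L, by omega⟩)) := by
      refine Or.inl ⟨⟨t, (hg i).2.2.1.trans hti, htv.trans (hsrc (v, _)).symm⟩, ?_, ?_⟩
      -- The slot is empty because payloads occupy only indices below `L`.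
      · rw [(hg _).2.2.1, Option.eq_none_iff_forall_ne_some]
        intro t' ht'
        have := lt_of_payload_initItem (hload v) ht'
        simp at this
      · rw [(hg _).2.1]
        rfl
    rw [← hiu, hσ i _ hslot]

end Routing

/-! ### Single-vertex networks, the round count, and the logarithmic factor. -/

theorem isRouted_of_subsingleton {n c : ℕ} [Subsingleton (Fin n)] (x : Fin n → NodeInput n c) :
    IsRouted x fun v => (x v).tokens :=
  ⟨rfl, fun _ _ _ _ _ => Subsingleton.elim _ _⟩

theorem routingSolvable_one (Δ c b : ℕ) (φ : ℝ) (L : ℕ) : RoutingSolvable Δ c b 1 φ L 0 :=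
  ⟨{ State := NodeInput 1 c
     init := fun _ x => x
     send := fun _ _ => ⟨0, by simp⟩
     receive := fun s _ => s
     output := fun s => s.tokens }, fun _ _ x _ => isRouted_of_subsingleton x⟩

theorem routingSolvable_of_sortingSolvable {Δ c b n L T : ℕ} {φ : ℝ} (hn : 2 ≤ n) (hL : 0 < L)
    (hLn : L ≤ n ^ c) (h : SortingSolvable Δ (6 * c + 5) b n φ (2 * L) T) :
    RoutingSolvable Δ c b n φ L (6 * T) := by
  have := (computes_routingSteps hn hLn h).mono (R' := fun x y => IsRoutingInput L x → IsRouted x y)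
    fun x y hxy hx => isRouted_of_routingSteps hL hx hxy
  rwa [show T + ((T + T) + ((T + T) + T)) = 6 * T by ring] at this

/-- For `n ≥ 2`, `L + 1 ≤ n ^ (c + 1)`; take logarithms to base `L + 1`. This pays for a constant
number of sorts. -/
theorem inv_le_logb {n c L : ℕ} (hn : 2 ≤ n) (hL : 0 < L) (hLn : L ≤ n ^ c) :
    ((c : ℝ) + 1)⁻¹ ≤ Real.logb ((L : ℝ) + 1) n := by
  have hL' : (1 : ℝ) < (L : ℝ) + 1 := by
    have : (0 : ℝ) < L := by exact_mod_cast hL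
    linarith
  have hle : (L : ℝ) + 1 ≤ (n : ℝ) ^ (c + 1) := by
    have h1 : 1 ≤ n ^ c := Nat.one_le_pow _ _ (by omega)
    have : L + 1 ≤ n ^ (c + 1) := by
      rw [pow_succ]
      nlinarith
    exact_mod_cast this
  have hlog : 1 ≤ ((c : ℝ) + 1) * Real.logb ((L : ℝ) + 1) n := by
    have := Real.logb_le_logb_of_le hL' (by linarith) hle
    rw [Real.logb_self_eq_one hL', Real.logb_pow] at this
    exact_mod_cast this
  rw [inv_le_iff_one_le_mul₀' (by positivity)]
  exact hlog

end Congest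

theorem mainTheorem9 (Δ c : ℕ) :
    ∃ C : ℝ, 0 < C ∧ ∀ T_sort : ℕ → ℝ → ℕ → ℕ,
      (∀ c' : ℕ, ∃ b : ℕ, ∀ (n : ℕ) (φ : ℝ) (L : ℕ),
        1 ≤ n → 0 < φ → 1 ≤ L → L ≤ n ^ c' →
          Congest.SortingSolvable Δ c' b n φ L (T_sort n φ L)) →
      ∃ b : ℕ, ∀ (n : ℕ) (φ : ℝ) (L : ℕ), 1 ≤ n → 0 < φ → 1 ≤ L → L ≤ n ^ c →
        ∃ t : ℕ, (t : ℝ) ≤ C * Real.logb ((L : ℝ) + 1) (n : ℝ) * (T_sort n φ (2 * L) : ℝ) ∧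
          Congest.RoutingSolvable Δ c b n φ L t := by
  -- Six sorts, each charged with the factor `c + 1` from `inv_le_logb`.
  refine ⟨6 * (c + 1), by positivity, fun T_sort hT => ?_⟩
  -- The exponent at which whole items fit into token contents, by `Item.card_le`.
  obtain ⟨b, hb⟩ := hT (6 * c + 5)
  refine ⟨b, fun n φ L hn hφ hL hLn => ?_⟩
  rcases Nat.lt_or_ge n 2 with hn2 | hn2
  · obtain rfl : n = 1 := by omega
    exact ⟨0, by simp, Congest.routingSolvable_one Δ c b φ L⟩
  · have hLn' : 2 * L ≤ n ^ (6 * c + 5) :=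
      calc 2 * L ≤ n * n ^ c := Nat.mul_le_mul hn2 hLn
        _ = n ^ (c + 1) := by ring
        _ ≤ n ^ (6 * c + 5) := Nat.pow_le_pow_right hn (by omega)
    refine ⟨6 * T_sort n φ (2 * L), ?_,
      Congest.routingSolvable_of_sortingSolvable hn2 hL hLn (hb n φ (2 * L) hn hφ (by omega) hLn')⟩
    have hlog := Congest.inv_le_logb hn2 hL hLn
    rw [inv_le_iff_one_le_mul₀' (by positivity)] at hlog
    push_cast
    have hT0 : (0 : ℝ) ≤ T_sort n φ (2 * L) := Nat.cast_nonneg _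
    calc (6 : ℝ) * T_sort n φ (2 * L) = 6 * 1 * T_sort n φ (2 * L) := by ring
      _ ≤ 6 * (((c : ℝ) + 1) * Real.logb ((L : ℝ) + 1) n) * T_sort n φ (2 * L) := by gcongr
      _ = _ := by ring
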